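/- Consider $m\ge 1$ identical processors and $W\ge 1$ unit independent tasks, scheduled by decentralized list scheduling (DLS): processor $i$ holds a queue with $w_i(t)$ tasks at time $t$, where the $W$ tasks are initially spread arbitrarily among the queues, so that $\sum_i w_i(0)=W$. In each time slot every processor with a non-empty queue executes (and removes) one task of its queue, and every processor with an empty queue sends a steal request to one of the other processors, chosen uniformly at random and independently of everything else (a lone processor, $m=1$, sends none). If a processor $i$ with $w_i(t)\ge 1$ receives at least one request, then one of its requesters $j$, chosen uniformly at random, is served: $w_i(t+1)=\lceil (w_i(t)-1)/2\rceil$ and $w_j(t+1)=\lfloor (w_i(t)-1)/2\rfloor$. If it receives none, $w_i(t+1)=w_i(t)-1$. Idle processors that are not served (all their requests being addressed to empty queues or lost in competition) remain empty. Let $C_{\max}=\min\{t : w_i(t)=0 \text{ for all } i\}$ be the makespan. Then $C_{\max}$ has finite expectation and $$\mathbb{E}[C_{\max}] \le \frac{W}{m} + 3.24\left(\log_2 W+\frac{1}{2\ln 2}\right)+1 .$$ -/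

import Mathlib

open MeasureTheory
open scoped ENNReal

namespace DLS

/-- The processors that processor `i` may address when the queue lengths are `w`. An idle processor
addresses one of the other processors; an active processor sends no request, which is encoded by
the value `i` itself (and so is the case of an idle processor that is alone, `m = 1`). -/
def targets {m : ℕ} (w : Fin m → ℕ) (i : Fin m) : Finset (Fin m) :=
  if w i = 0 ∧ (Finset.univ.erase i).Nonempty then Finset.univ.erase i else {i}

/-- The processors whose steal request is sent to processor `k`, when `c i` is the processor
addressed by processor `i`. -/
def requesters {m : ℕ} (c : Fin m → Fin m) (k : Fin m) : Finset (Fin m) :=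
  Finset.univ.filter fun i => i ≠ k ∧ c i = k

/-- The requesters among which the one served by processor `k` is drawn; the dummy value `k` is
used when nobody addresses `k`. -/
def candidates {m : ℕ} (c : Fin m → Fin m) (k : Fin m) : Finset (Fin m) :=
  if (requesters c k).Nonempty then requesters c k else {k}

theorem targets_nonempty {m : ℕ} (w : Fin m → ℕ) :
    (Fintype.piFinset (targets w)).Nonempty := by
  rw [Fintype.piFinset_nonempty]
  intro i
  unfold targets
  split_ifs with h
  · exact h.2
  · exact Finset.singleton_nonempty i

theorem candidates_nonempty {m : ℕ} (c : Fin m → Fin m) :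
    (Fintype.piFinset (candidates c)).Nonempty := by
  rw [Fintype.piFinset_nonempty]
  intro k
  unfold candidates
  split_ifs with h
  · exact h
  · exact Finset.singleton_nonempty k

/-- Queue lengths after one time slot, given the queue lengths `w`, the addressed processors `c`
and the served requesters `s`. An active processor executes one task; if it is addressed, it keeps
`⌈(w i - 1) / 2⌉` of its `w i - 1` remaining tasks and the served requester receives
`⌊(w i - 1) / 2⌋` tasks. Nothing is transferred from a queue with at most one task. -/
def nextLoad {m : ℕ} (w : Fin m → ℕ) (c s : Fin m → Fin m) (i : Fin m) : ℕ :=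
  if w i = 0 then
    if c i ≠ i ∧ s (c i) = i then (w (c i) - 1) / 2 else 0
  else
    if (requesters c i).Nonempty then (w i - 1) - (w i - 1) / 2 else w i - 1

/-- The law of the queue lengths after one time slot: the idle processors address, independently,
uniformly random other processors, then each addressed processor serves a uniformly random one
of its requesters, independently of the others. (The uniform law on a product of finite sets is
the law of independent uniform coordinates.) -/
noncomputable def step {m : ℕ} (w : Fin m → ℕ) : PMF (Fin m → ℕ) :=
  (PMF.uniformOfFinset (Fintype.piFinset (targets w)) (targets_nonempty w)).bind fun c =>
    (PMF.uniformOfFinset (Fintype.piFinset (candidates c)) (candidates_nonempty c)).map fun s =>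
      nextLoad w c s

/-- `w t ω i` is the number of tasks in the queue of processor `i` at time `t` in a run of
decentralized list scheduling of `W` unit independent tasks on `m` processors: initially the `W`
tasks are spread arbitrarily (possibly at random), and then the queue lengths evolve as a Markov
chain with transition law `step`. -/
structure IsExecution {Ω : Type*} [MeasurableSpace Ω] (μ : Measure Ω) (m W : ℕ)
    (w : ℕ → Ω → Fin m → ℕ) : Prop where
  measurable : ∀ t, Measurable (w t)
  initial : ∀ᵐ ω ∂μ, ∑ i, w 0 ω i = W
  transition : ∀ (t : ℕ) (x : ℕ → Fin m → ℕ),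
    μ {ω | ∀ u ≤ t + 1, w u ω = x u} = μ {ω | ∀ u ≤ t, w u ω = x u} * step (x t) (x (t + 1))

/-- The makespan of a trajectory of queue lengths: the first time at which all queues are empty
(`∞` if there is none). -/
noncomputable def makespan {m : ℕ} (x : ℕ → Fin m → ℕ) : ℝ≥0∞ :=
  ⨅ (t : ℕ) (_ : ∀ i, x t i = 0), (t : ℝ≥0∞)

end DLS

namespace DLS

/-! ### The concave profile of the potential -/

/-! The proof is a drift argument. Let `r` be the number of idle processors, `Φ` the sum of the
cubes of the loads, and `V = (total load) / m + profile Φ`. Until all queues are empty, `V` loses at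
least 1 per slot in expectation (`lyapunov_drift`); summing over time bounds the expected number of
nonempty slots by the initial `V`. The mean load falls by at least `1 - r/m`, so `profile Φ` must
pay for the idle fraction `r/m`. A queue that is addressed keeps at most 1/4 of its cube across the
two halves, and it escapes all requests with probability at most `exp (-y)`, where `y = r/(m-1)`.
Hence `Φ` contracts on average by a factor `h ≤ 1/4 + 3/4 exp (-y)`. Jensen for the concave profile,
then `profile_contraction`, give a loss of at least `y ≥ r/m`. Since `Φ ≤ W^3` initially, the
logarithmic slope `1.08 / log 2` yields the constant `3.24 = 3 * 1.08`. -/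

/-- The profile `3 y` up to `y = 1`, continued by `3 + (1.08 / log 2) log y`. -/
noncomputable def profile (y : ℝ) : ℝ :=
  if y ≤ 1 then 3 * y else 3 + 27 / 25 / Real.log 2 * Real.log y

theorem slope_pos : 0 < 27 / 25 / Real.log 2 := by
  have := Real.log_pos one_lt_two
  positivity

theorem slope_le : 27 / 25 / Real.log 2 ≤ 3 := by
  have := Real.log_two_gt_d9
  rw [div_le_iff₀ (by linarith)]
  linarith

theorem profile_of_one_le {y : ℝ} (hy : 1 ≤ y) :
    profile y = 3 + 27 / 25 / Real.log 2 * Real.log y := by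
  unfold profile
  split_ifs with h
  · have : y = 1 := le_antisymm h hy
    simp [this]
  · rfl

theorem profile_le_three_mul {y : ℝ} : profile y ≤ 3 * y := by
  unfold profile
  split_ifs with h
  · rfl
  · push Not at h
    have h1 := Real.log_le_sub_one_of_pos (by linarith : 0 < y)
    have h2 := Real.log_nonneg h.le
    nlinarith [slope_le, slope_pos]

theorem profile_nonneg {y : ℝ} (hy : 0 ≤ y) : 0 ≤ profile y := by
  unfold profile
  split_ifs with h
  · linarith
  · push Not at h
    have h2 := Real.log_nonneg h.le
    nlinarith [slope_pos]

theorem profile_mono {x y : ℝ} (hxy : x ≤ y) : profile x ≤ profile y := by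
  rcases le_total y 1 with hy | hy
  · simp only [profile, if_pos hy, if_pos (hxy.trans hy)]
    linarith
  · rw [profile_of_one_le hy]
    have hc := slope_pos
    rcases le_total x 1 with hx | hx
    · simp only [profile, if_pos hx]
      nlinarith [Real.log_nonneg hy]
    · rw [profile_of_one_le hx]
      have := Real.log_le_log (by linarith) hxy
      nlinarith

/-- Concavity, in the form used for Jensen; it rests on the slope not increasing at the junction,
`slope_le`. -/
theorem profile_exists_supporting_line {z : ℝ} (hz : 0 < z) :
    ∃ s : ℝ, ∀ y, 0 ≤ y → profile y ≤ profile z + s * (y - z) := by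
  rcases le_total z 1 with hz1 | hz1
  · refine ⟨3, fun y _ => ?_⟩
    have : profile z = 3 * z := if_pos hz1
    linarith [profile_le_three_mul (y := y)]
  · have hc := slope_pos
    have hc3 := slope_le
    set c := 27 / 25 / Real.log 2 with hcdef
    refine ⟨c / z, fun y hy => ?_⟩
    rw [profile_of_one_le hz1, ← hcdef]
    have key : ∀ u, 1 ≤ u → 3 + c * Real.log u ≤ 3 + c * Real.log z + c / z * (u - z) := by
      intro u hu
      have h1 := Real.log_le_sub_one_of_pos (by positivity : 0 < u / z)
      rw [Real.log_div (by positivity) (by positivity)] at h1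
      have h2 : c / z * (u - z) = c * (u / z - 1) := by field_simp
      rw [h2]
      nlinarith
    -- For `y ≤ 1` both sides are affine: `y = 1` is `key`, and `y = 0` follows from `c ≤ 3`.
    rcases le_total y 1 with hy1 | hy1
    · have h1 := key 1 le_rfl
      have h0 : c / z * (y - z) = c / z * y - c := by field_simp
      have h0' : c / z * (1 - z) = c / z - c := by field_simp
      have hl := Real.log_nonneg hz1
      rw [Real.log_one, h0'] at h1
      rw [h0, profile, if_pos hy1]
      nlinarith [mul_nonneg hc.le hl]
    · rw [profile_of_one_le hy1]
      exact key y hy1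

/-! ### The contraction factor -/

theorem contraction_at_one :
    1 / 4 + 3 / 4 * Real.exp (-1) ≤ Real.exp (-(Real.log 2 / (27 / 25))) := by
  have he : Real.exp (-1) ≤ 1 / 2.7182818283 := by
    rw [Real.exp_neg, ← one_div]
    exact one_div_le_one_div_of_le (by norm_num) Real.exp_one_gt_d9.le
  have h1 : 1 / 4 + 3 / 4 * Real.exp (-1) ≤ 1 / 4 + 3 / 4 * (1 / 2.7182818283) := by linarith
  refine h1.trans ?_
  rw [← Real.log_le_iff_le_exp (by norm_num)]
  -- This numerical fact is what allows 1.08 = 27/25.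
  have h2 : (1 / 4 + 3 / 4 * (1 / 2.7182818283) : ℝ) ^ 27 ≤ (1 / 2) ^ 25 := by norm_num
  have h3 := Real.log_le_log (by positivity) h2
  rw [Real.log_pow, Real.log_pow, one_div (2 : ℝ), Real.log_inv] at h3
  push_cast at h3
  linarith

/-- With `z = exp (-(y * a))` the claim reads `1/4 + 3/4 z^c ≤ z`. The left side is convex as `c ≥
1`, so the endpoints `y = 0` (equality) and `y = 1` suffice. -/
theorem contraction_le {y : ℝ} (h0 : 0 ≤ y) (h1 : y ≤ 1) :
    1 / 4 + 3 / 4 * Real.exp (-y) ≤ Real.exp (-(y * (Real.log 2 / (27 / 25)))) := by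
  have hc : 1 ≤ 27 / 25 / Real.log 2 := by
    have h2 := Real.log_two_lt_d9
    rw [le_div_iff₀ (Real.log_pos one_lt_two)]
    linarith
  have hl := Real.log_pos one_lt_two
  set a := Real.log 2 / (27 / 25) with ha
  have hapos : 0 < a := by positivity
  have hac : a * (27 / 25 / Real.log 2) = 1 := by rw [ha]; field_simp
  set c := 27 / 25 / Real.log 2
  have hexp : ∀ t : ℝ, Real.exp (-t) = Real.exp (-(t * a)) ^ c := by
    intro t
    rw [← Real.exp_mul]
    congr 1
    linear_combination t * hac
  set z1 := Real.exp (-(1 * a)) with hz1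
  set z := Real.exp (-(y * a)) with hz
  have hz11 : z1 < 1 := by rw [hz1, Real.exp_lt_one_iff]; linarith
  have hzz1 : z1 ≤ z := by rw [hz1, hz, Real.exp_le_exp]; nlinarith
  have hzle : z ≤ 1 := by rw [hz, Real.exp_le_one_iff]; nlinarith
  have hend : 1 / 4 + 3 / 4 * z1 ^ c ≤ z1 := by
    rw [hz1, ← hexp, one_mul]
    exact contraction_at_one
  rw [hexp y, ← hz]
  have hconv := (convexOn_rpow hc).2 ((Real.exp_pos _).le : z1 ∈ Set.Ici 0)
    (by norm_num : (1 : ℝ) ∈ Set.Ici 0)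
    (div_nonneg (by linarith) (by linarith) : 0 ≤ (1 - z) / (1 - z1))
    (div_nonneg (by linarith) (by linarith) : 0 ≤ (z - z1) / (1 - z1))
    (by rw [← add_div, div_eq_one_iff_eq (by linarith)]; ring)
  have hmix : (1 - z) / (1 - z1) * z1 + (z - z1) / (1 - z1) * 1 = z := by
    have : 1 - z1 ≠ 0 := by linarith
    field_simp
    ring
  simp only [← hz1, smul_eq_mul, hmix, Real.one_rpow] at hconv
  have hA : 0 ≤ (1 - z) / (1 - z1) := div_nonneg (by linarith) (by linarith)
  have hsum : (1 - z) / (1 - z1) + (z - z1) / (1 - z1) = 1 := by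
    rw [← add_div, div_eq_one_iff_eq (by linarith)]; ring
  nlinarith [mul_le_mul_of_nonneg_left hend hA]

/-- On the logarithmic branch the loss is `-c log h ≥ y`. If `h * Φ < 1`, the left side is affine in
`Φ` and the right side concave on `[1, 1/h]`, so the endpoints suffice; at `Φ = 1` slope 3 is steep
enough because `1 - h ≥ y/3`. -/
theorem profile_contraction {y h Φ : ℝ} (h0 : 0 ≤ y) (h1 : y ≤ 1) (hpos : 0 < h)
    (hh : h ≤ 1 / 4 + 3 / 4 * Real.exp (-y)) (hΦ : 1 ≤ Φ) :
    profile (h * Φ) + y ≤ profile Φ := by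
  have hc := slope_pos
  have hlog : y ≤ -(27 / 25 / Real.log 2 * Real.log h) := by
    have h2 := Real.log_le_log hpos (hh.trans (contraction_le h0 h1))
    rw [Real.log_exp] at h2
    have hl := Real.log_pos one_lt_two
    have h3 := mul_le_mul_of_nonneg_left h2 hc.le
    have h4 : 27 / 25 / Real.log 2 * -(y * (Real.log 2 / (27 / 25))) = -y := by field_simp
    linarith
  have hone : y ≤ 3 * (1 - h) := by
    have h2 : Real.exp (-y) ≤ 1 / (1 + y) := by
      rw [Real.exp_neg, ← one_div]
      exact one_div_le_one_div_of_le (by linarith) (by linarith [Real.add_one_le_exp y])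
    have h3 : 1 / (1 + y) ≤ 1 - y / 2 := by
      rw [div_le_iff₀ (by linarith)]
      nlinarith
    linarith
  rw [profile_of_one_le hΦ]
  set c := 27 / 25 / Real.log 2
  rcases le_or_gt 1 (h * Φ) with hz | hz
  · rw [profile_of_one_le hz, Real.log_mul hpos.ne' (by linarith)]
    linarith
  · rw [profile, if_pos hz.le]
    have hh1 : h < 1 := by nlinarith
    have hd : 0 < 1 - h := by linarith
    set b := h * (Φ - 1) / (1 - h) with hb
    have hb0 : 0 ≤ b := div_nonneg (mul_nonneg hpos.le (by linarith)) hd.le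
    have hb1 : b ≤ 1 := by rw [hb, div_le_one hd]; linarith
    have hbh : b * (1 - h) = h * Φ - h := by rw [hb]; field_simp
    have hconc := strictConcaveOn_log_Ioi.concaveOn.2
      (by norm_num : (1 : ℝ) ∈ Set.Ioi 0) (inv_pos.2 hpos : h⁻¹ ∈ Set.Ioi 0)
      (by linarith : 0 ≤ 1 - b) hb0 (by ring)
    have hmix : (1 - b) * 1 + b * h⁻¹ = Φ := by
      field_simp
      linarith
    simp only [smul_eq_mul, hmix, Real.log_one, Real.log_inv] at hconc
    nlinarith [mul_le_mul_of_nonneg_left hconc hc.le, mul_le_mul_of_nonneg_left hlog hb0,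
      mul_le_mul_of_nonneg_left hone (by linarith : 0 ≤ 1 - b)]

/-! ### One time slot -/

/-- The stolen halves are charged to their victims: each victim `k` serves only `s k`. -/
theorem sum_nextLoad_le {m : ℕ} (w : Fin m → ℕ) (c s : Fin m → Fin m) (f : ℕ → ℕ) (hf : f 0 = 0) :
    ∑ i, f (nextLoad w c s i) ≤ ∑ k, if w k = 0 then 0 else
      if (requesters c k).Nonempty then f ((w k - 1) - (w k - 1) / 2) + f ((w k - 1) / 2)
      else f (w k - 1) := by
  have h1 : ∀ i, f (nextLoad w c s i) ≤
      (if w i = 0 then 0 else if (requesters c i).Nonempty then f ((w i - 1) - (w i - 1) / 2)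
        else f (w i - 1)) +
      ∑ k, if i = s k ∧ i ∈ requesters c k then f ((w k - 1) / 2) else 0 := by
    intro i
    unfold nextLoad
    split_ifs with h2 h3 h4
    · refine le_add_left ?_
      refine le_trans ?_ (Finset.single_le_sum (fun _ _ => Nat.zero_le _) (Finset.mem_univ (c i)))
      rw [if_pos]
      exact ⟨h3.2.symm, by simp [requesters, Ne.symm h3.1]⟩
    · simp [hf]
    · exact Nat.le_add_right _ _
    · exact Nat.le_add_right _ _
  refine (Finset.sum_le_sum fun i _ => h1 i).trans ?_
  rw [Finset.sum_add_distrib, Finset.sum_comm, ← Finset.sum_add_distrib]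
  refine Finset.sum_le_sum fun k _ => ?_
  have h2 : (∑ i, if i = s k ∧ i ∈ requesters c k then f ((w k - 1) / 2) else 0) =
      if s k ∈ requesters c k then f ((w k - 1) / 2) else 0 := by
    simp only [ite_and]
    simp
  rw [h2]
  by_cases hw : w k = 0
  · simp [hw, hf]
  · rw [if_neg hw, if_neg hw]
    by_cases hr : (requesters c k).Nonempty
    · rw [if_pos hr, if_pos hr]
      split_ifs <;> simp
    · rw [if_neg hr, if_neg hr, if_neg fun h => hr ⟨_, h⟩, add_zero]

theorem sum_nextLoad_add_card_le {m : ℕ} (w : Fin m → ℕ) (c s : Fin m → Fin m) :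
    ∑ i, nextLoad w c s i + (Finset.univ.filter fun i => w i ≠ 0).card ≤ ∑ i, w i := by
  have h := sum_nextLoad_le w c s id rfl
  rw [Finset.card_filter]
  refine (Nat.add_le_add_right h _).trans ?_
  rw [← Finset.sum_add_distrib]
  refine Finset.sum_le_sum fun k _ => ?_
  simp only [id]
  split_ifs <;> omega

/-- The task executed before splitting absorbs the rounding of the halves. -/
theorem four_mul_cube_halves_le {n : ℕ} (hn : n ≠ 0) :
    4 * (((n - 1) - (n - 1) / 2) ^ 3 + ((n - 1) / 2) ^ 3) ≤ n ^ 3 := by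
  obtain ⟨k, rfl | rfl⟩ : ∃ k, n = 2 * k + 1 ∨ n = 2 * k + 2 := ⟨(n - 1) / 2, by omega⟩
  · have h1 : (2 * k + 1 - 1) / 2 = k := by omega
    have h2 : 2 * k + 1 - 1 - k = k := by omega
    rw [h1, h2]
    ring_nf
    nlinarith
  · have h1 : (2 * k + 2 - 1) / 2 = k := by omega
    have h2 : 2 * k + 2 - 1 - k = k + 1 := by omega
    rw [h1, h2]
    ring_nf
    nlinarith

/-- An upper bound, in terms of the addressed processors only, of the sum of the cubes of the
queue lengths after one time slot. -/
noncomputable def cubeBound {m : ℕ} (w : Fin m → ℕ) (c : Fin m → Fin m) : ℝ :=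
  ∑ k, (w k : ℝ) ^ 3 * (1 / 4 + 3 / 4 * if requesters c k = ∅ then 1 else 0)

theorem cubeBound_nonneg {m : ℕ} (w : Fin m → ℕ) (c : Fin m → Fin m) : 0 ≤ cubeBound w c :=
  Finset.sum_nonneg fun k _ => mul_nonneg (by positivity) (by split_ifs <;> norm_num)

theorem sum_cube_nextLoad_le {m : ℕ} (w : Fin m → ℕ) (c s : Fin m → Fin m) :
    ∑ i, (nextLoad w c s i : ℝ) ^ 3 ≤ cubeBound w c := by
  have h := sum_nextLoad_le w c s (fun n => n ^ 3) rfl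
  have h' : ((∑ i, nextLoad w c s i ^ 3 : ℕ) : ℝ) ≤ _ := Nat.cast_le.2 h
  push_cast at h'
  refine h'.trans (Finset.sum_le_sum fun k _ => ?_)
  by_cases hw : w k = 0
  · simp [hw]
  · rw [if_neg hw]
    by_cases hr : requesters c k = ∅
    · have h1 : ((w k - 1 : ℕ) : ℝ) ≤ w k := Nat.cast_le.2 (Nat.sub_le _ _)
      simp only [hr, Finset.not_nonempty_empty, if_true, if_false]
      have h2 := pow_le_pow_left₀ (Nat.cast_nonneg _) h1 3
      linarith
    · have h1 : ((4 * (((w k - 1) - (w k - 1) / 2) ^ 3 + ((w k - 1) / 2) ^ 3) : ℕ) : ℝ) ≤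
          ((w k ^ 3 : ℕ) : ℝ) := Nat.cast_le.2 (four_mul_cube_halves_le hw)
      rw [if_pos (Finset.nonempty_iff_ne_empty.2 hr), if_neg hr]
      push_cast at h1 ⊢
      linarith

/-! ### Averaging over the requests -/

theorem card_requesters_eq_empty {m : ℕ} (w : Fin m → ℕ) {k : Fin m} (hk : w k ≠ 0) :
    (((Fintype.piFinset (targets w)).filter fun c => requesters c k = ∅).card : ℝ) =
      (1 - 1 / ((m : ℝ) - 1)) ^ (Finset.univ.filter fun i => w i = 0).card *
        (Fintype.piFinset (targets w)).card := by
  -- Avoiding `k` is a coordinatewise condition: each idle processor loses one of its `m - 1`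
  -- targets.
  have h1 : ((Fintype.piFinset (targets w)).filter fun c => requesters c k = ∅) =
      Fintype.piFinset fun i => if w i = 0 then (targets w i).erase k else targets w i := by
    ext c
    simp only [Finset.mem_filter, Fintype.mem_piFinset, requesters, Finset.filter_eq_empty_iff,
      Finset.mem_univ, true_implies]
    rw [← forall_and]
    refine forall_congr' fun i => ?_
    split_ifs with hi
    · have : i ≠ k := by rintro rfl; exact hk hi
      simp only [Finset.mem_erase]
      tauto
    · have : targets w i = {i} := by simp [targets, hi]
      rw [this, Finset.mem_singleton]
      constructor
      · exact And.left
      · intro h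
        rw [h]
        tauto
  rw [h1, Fintype.card_piFinset, Fintype.card_piFinset, Finset.card_filter,
    ← Finset.prod_pow_eq_pow_sum]
  push_cast
  rw [← Finset.prod_mul_distrib]
  refine Finset.prod_congr rfl fun i _ => ?_
  by_cases hi : w i = 0
  · have hik : k ≠ i := by rintro rfl; exact hk hi
    have hne : (Finset.univ.erase i).Nonempty := ⟨k, by simp [hik]⟩
    have hm : 2 ≤ m := by
      have := Finset.one_lt_card.2 ⟨k, Finset.mem_univ k, i, Finset.mem_univ i, hik⟩
      rwa [Finset.card_univ, Fintype.card_fin] at this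
    have ht : targets w i = Finset.univ.erase i := by simp only [targets, if_pos (And.intro hi hne)]
    rw [if_pos hi, if_pos hi, ht, Finset.card_erase_of_mem (by simp [hik]),
      Finset.card_erase_of_mem (Finset.mem_univ i), Finset.card_univ, Fintype.card_fin]
    obtain ⟨n, rfl⟩ := Nat.exists_eq_add_of_le hm
    have e1 : 2 + n - 1 - 1 = n := by omega
    have e2 : 2 + n - 1 = n + 1 := by omega
    rw [e1, e2]
    have e3 : ((2 + n : ℕ) : ℝ) - 1 = n + 1 := by push_cast; ring
    have : (n : ℝ) + 1 ≠ 0 := by positivity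
    rw [e3]
    push_cast
    field_simp
    ring
  · simp [hi]

theorem sum_cubeBound {m : ℕ} (w : Fin m → ℕ) :
    ∑ c ∈ Fintype.piFinset (targets w), cubeBound w c =
      (Fintype.piFinset (targets w)).card *
        ((1 / 4 + 3 / 4 * (1 - 1 / ((m : ℝ) - 1)) ^ (Finset.univ.filter fun i => w i = 0).card) *
          ∑ k, (w k : ℝ) ^ 3) := by
  unfold cubeBound
  rw [Finset.sum_comm, Finset.mul_sum, Finset.mul_sum]
  refine Finset.sum_congr rfl fun k _ => ?_
  by_cases hk : w k = 0
  · simp [hk]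
  · rw [← Finset.mul_sum, Finset.sum_add_distrib, ← Finset.mul_sum, Finset.sum_boole,
      card_requesters_eq_empty w hk, Finset.sum_const, nsmul_eq_mul]
    ring

theorem sum_profile_cubeBound_le {m : ℕ} (w : Fin m → ℕ) (hw : w ≠ 0) :
    ∑ c ∈ Fintype.piFinset (targets w), profile (cubeBound w c) ≤
      (Fintype.piFinset (targets w)).card * (profile (∑ k, (w k : ℝ) ^ 3) -
        (Finset.univ.filter fun i => w i = 0).card / m) := by
  obtain ⟨k, hk⟩ : ∃ k, w k ≠ 0 := Function.ne_iff.1 hw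
  set r := (Finset.univ.filter fun i => w i = 0).card with hr
  have hrm : r + 1 ≤ m := by
    have : r < (Finset.univ : Finset (Fin m)).card :=
      Finset.card_lt_card ⟨Finset.filter_subset _ _,
        fun h => hk (by simpa using h (Finset.mem_univ k))⟩
    simpa using this
  have hΦ : 1 ≤ ∑ k, (w k : ℝ) ^ 3 := by
    refine le_trans ?_ (Finset.single_le_sum (f := fun k => (w k : ℝ) ^ 3)
      (fun _ _ => by positivity) (Finset.mem_univ k))
    exact one_le_pow₀ (Nat.one_le_cast.2 (Nat.one_le_iff_ne_zero.2 hk))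
  have hmean := sum_cubeBound w
  rw [← hr] at hmean
  set Φ := ∑ k, (w k : ℝ) ^ 3
  have hrm' : (r : ℝ) ≤ (m : ℝ) - 1 := by
    have : ((r + 1 : ℕ) : ℝ) ≤ m := Nat.cast_le.2 hrm
    push_cast at this
    linarith
  have hr0 : (0 : ℝ) ≤ r := Nat.cast_nonneg r
  -- For `m = 1` the quotient is `1 / 0 = 0`, and `r = 0`.
  have hq1 : 1 / ((m : ℝ) - 1) ≤ 1 := by
    rcases Nat.lt_or_ge m 2 with h2 | h2
    · have : m = 1 := by omega
      simp [this]
    · have : (2 : ℝ) ≤ m := by exact_mod_cast h2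
      rw [div_le_one (by linarith)]
      linarith
  have hq0 : 0 ≤ (1 - 1 / ((m : ℝ) - 1)) ^ r := pow_nonneg (by linarith) _
  have hq : (1 - 1 / ((m : ℝ) - 1)) ^ r ≤ Real.exp (-(r / ((m : ℝ) - 1))) := by
    refine (pow_le_pow_left₀ (by linarith) (Real.one_sub_le_exp_neg _) r).trans_eq ?_
    rw [← Real.exp_nat_mul]
    congr 1
    ring
  set q := (1 - 1 / ((m : ℝ) - 1)) ^ r
  have hcontr := profile_contraction (y := r / ((m : ℝ) - 1)) (h := 1 / 4 + 3 / 4 * q) (Φ := Φ)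
    (div_nonneg hr0 (by linarith)) (div_le_one_of_le₀ hrm' (by linarith)) (by linarith)
    (by linarith) hΦ
  have hfrac : (r : ℝ) / m ≤ r / ((m : ℝ) - 1) := by
    rcases hr0.eq_or_lt with h | h
    · simp [← h]
    · exact div_le_div_of_nonneg_left hr0 (by linarith) (by linarith)
  obtain ⟨a, ha⟩ := profile_exists_supporting_line
    (z := (1 / 4 + 3 / 4 * q) * Φ) (by positivity)
  refine (Finset.sum_le_sum fun c _ => ha _ (cubeBound_nonneg w c)).trans ?_
  rw [Finset.sum_add_distrib, ← Finset.mul_sum, Finset.sum_sub_distrib, hmean]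
  simp only [Finset.sum_const, nsmul_eq_mul, sub_self, mul_zero, add_zero]
  exact mul_le_mul_of_nonneg_left (by linarith) (Nat.cast_nonneg _)

/-- The Lyapunov function: the mean load plus the profile of the sum of the cubes. -/
noncomputable def lyapunov {m : ℕ} (w : Fin m → ℕ) : ℝ :=
  (∑ i, (w i : ℝ)) / m + profile (∑ i, (w i : ℝ) ^ 3)

theorem lyapunov_nextLoad_le {m : ℕ} (hm : 1 ≤ m) (w : Fin m → ℕ) (c s : Fin m → Fin m) :
    lyapunov (nextLoad w c s) ≤ (∑ i, (w i : ℝ)) / m - 1 +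
      (Finset.univ.filter fun i => w i = 0).card / m + profile (cubeBound w c) := by
  refine add_le_add ?_ (profile_mono (sum_cube_nextLoad_le w c s))
  have h1 : ((∑ i, nextLoad w c s i + (Finset.univ.filter fun i => w i ≠ 0).card : ℕ) : ℝ) ≤
    ((∑ i, w i : ℕ) : ℝ) := Nat.cast_le.2 (sum_nextLoad_add_card_le w c s)
  have h2 : (((Finset.univ.filter fun i => w i = 0).card +
      (Finset.univ.filter fun i => w i ≠ 0).card : ℕ) : ℝ) = m := by
    rw [Finset.card_filter_add_card_filter_not, Finset.card_univ, Fintype.card_fin]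
  push_cast at h1 h2
  have hm' : (0 : ℝ) < m := by exact_mod_cast hm
  have h3 : (∑ i, (w i : ℝ)) / m - 1 + (Finset.univ.filter fun i => w i = 0).card / m =
      (∑ i, (w i : ℝ) - m + (Finset.univ.filter fun i => w i = 0).card) / m := by
    field_simp
  rw [h3]
  gcongr
  linarith

/-- Only the addresses `c` need averaging; the bound is uniform in the served requesters `s`. -/
theorem tsum_step_mul_le {m : ℕ} (w : Fin m → ℕ) (f : (Fin m → ℕ) → ℝ≥0∞)
    (g : (Fin m → Fin m) → ℝ≥0∞) (h : ∀ c s, f (nextLoad w c s) ≤ g c) :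
    ∑' y, step w y * f y ≤
      ∑ c ∈ Fintype.piFinset (targets w), ((Fintype.piFinset (targets w)).card : ℝ≥0∞)⁻¹ * g c := by
  have hbind : ∀ {α β : Type} (p : PMF α) (k : α → PMF β) (f : β → ℝ≥0∞),
      ∑' y, p.bind k y * f y = ∑' a, p a * ∑' y, k a y * f y := by
    intro α β p k f
    simp only [PMF.bind_apply, ← ENNReal.tsum_mul_right, ← ENNReal.tsum_mul_left]
    rw [ENNReal.tsum_comm]
    simp only [mul_assoc]
  rw [step, hbind, tsum_eq_sum (s := Fintype.piFinset (targets w))]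
  · refine Finset.sum_le_sum fun c hc => ?_
    rw [PMF.uniformOfFinset_apply_of_mem _ hc]
    refine mul_le_mul_right ?_ _
    rw [← PMF.bind_pure_comp, hbind]
    calc _ ≤ ∑' s, PMF.uniformOfFinset (Fintype.piFinset (candidates c)) (candidates_nonempty c) s
          * g c := by
            refine ENNReal.tsum_le_tsum fun s => mul_le_mul_right ?_ _
            rw [tsum_eq_single (nextLoad w c s)]
            · simpa using h c s
            · intro y hy
              simp [hy]
      _ = g c := by rw [ENNReal.tsum_mul_right, PMF.tsum_coe, one_mul]
  · intro c hc
    rw [PMF.uniformOfFinset_apply_of_notMem _ hc, zero_mul]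

theorem lyapunov_drift {m : ℕ} (hm : 1 ≤ m) (w : Fin m → ℕ) :
    (if w = 0 then 0 else 1) + ∑' y, step w y * ENNReal.ofReal (lyapunov y) ≤
      ENNReal.ofReal (lyapunov w) := by
  by_cases hw : w = 0
  · subst hw
    have h0 : ∀ c s : Fin m → Fin m, nextLoad (0 : Fin m → ℕ) c s = 0 := by
      intro c s
      funext i
      simp [nextLoad]
    have hl : lyapunov (0 : Fin m → ℕ) = 0 := by simp [lyapunov, profile]
    rw [if_pos rfl, zero_add]
    refine (tsum_step_mul_le 0 _ (fun _ => 0) fun c s => ?_).trans (by simp)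
    rw [h0, hl, ENNReal.ofReal_zero]
  · rw [if_neg hw]
    set C := Fintype.piFinset (targets w)
    set r := (Finset.univ.filter fun i => w i = 0).card
    have hC : (0 : ℝ) < C.card := by
      exact_mod_cast Finset.card_pos.2 (targets_nonempty w)
    -- Each processor is idle or holds a task; this keeps the bounds nonnegative, so
    -- `ENNReal.ofReal` does not truncate.
    have hmean : (1 : ℝ) ≤ (∑ i, (w i : ℝ)) / m + r / m := by
      have hm' : (0 : ℝ) < m := by exact_mod_cast hm
      rw [← add_div, le_div_iff₀ hm', one_mul]
      have : m ≤ ∑ i, w i + r := by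
        have : ∑ i : Fin m, 1 ≤ ∑ i, (w i + if w i = 0 then 1 else 0) :=
          Finset.sum_le_sum fun i _ => by split_ifs <;> omega
        rw [Finset.sum_add_distrib, ← Finset.card_filter] at this
        simpa using this
      exact_mod_cast this
    have hnn : ∀ c, 0 ≤ (∑ i, (w i : ℝ)) / m - 1 + r / m + profile (cubeBound w c) := fun c => by
      have := profile_nonneg (cubeBound_nonneg w c)
      linarith
    have hstep := tsum_step_mul_le w (fun y => ENNReal.ofReal (lyapunov y))
      (fun c => ENNReal.ofReal ((∑ i, (w i : ℝ)) / m - 1 + r / m + profile (cubeBound w c)))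
      fun c s => ENNReal.ofReal_le_ofReal (lyapunov_nextLoad_le hm w c s)
    have havg : ∑ c ∈ C, (C.card : ℝ)⁻¹ *
        ((∑ i, (w i : ℝ)) / m - 1 + r / m + profile (cubeBound w c)) ≤ lyapunov w - 1 := by
      have h1 := sum_profile_cubeBound_le w hw
      rw [← Finset.mul_sum, inv_mul_le_iff₀ hC, Finset.sum_add_distrib, Finset.sum_const,
        nsmul_eq_mul]
      refine (add_le_add_right h1 _).trans_eq ?_
      simp only [lyapunov]
      ring
    have hnn' : 0 ≤ ∑ c ∈ C, (C.card : ℝ)⁻¹ *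
        ((∑ i, (w i : ℝ)) / m - 1 + r / m + profile (cubeBound w c)) :=
      Finset.sum_nonneg fun c _ => mul_nonneg (by positivity) (hnn c)
    have hsum : ∑ c ∈ C, (C.card : ℝ≥0∞)⁻¹ *
        ENNReal.ofReal ((∑ i, (w i : ℝ)) / m - 1 + r / m + profile (cubeBound w c)) =
        ENNReal.ofReal (∑ c ∈ C, (C.card : ℝ)⁻¹ *
          ((∑ i, (w i : ℝ)) / m - 1 + r / m + profile (cubeBound w c))) := by
      rw [ENNReal.ofReal_sum_of_nonneg fun c _ => mul_nonneg (by positivity) (hnn c)]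
      refine Finset.sum_congr rfl fun c _ => ?_
      rw [ENNReal.ofReal_mul (by positivity), ENNReal.ofReal_inv_of_pos hC, ENNReal.ofReal_natCast]
    calc _ ≤ ENNReal.ofReal 1 + ENNReal.ofReal (lyapunov w - 1) := by
          rw [ENNReal.ofReal_one]
          exact add_le_add_right (hstep.trans (hsum.le.trans (ENNReal.ofReal_le_ofReal havg))) _
      _ = _ := by
          rw [← ENNReal.ofReal_add zero_le_one (hnn'.trans havg)]
          congr 1
          ring

theorem lyapunov_le {m W : ℕ} (hW : 1 ≤ W) (w : Fin m → ℕ) (hw : ∑ i, w i = W) :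
    lyapunov w ≤ (W : ℝ) / m + 3.24 * (Real.logb 2 W + 1 / (2 * Real.log 2)) + 1 := by
  have hsum : ∑ i, (w i : ℝ) = W := by exact_mod_cast hw
  have hcube : ∑ i, (w i : ℝ) ^ 3 ≤ (W : ℝ) ^ 3 := by
    have h : ∀ i, (w i : ℝ) ^ 3 ≤ (W : ℝ) ^ 2 * w i := by
      intro i
      have hi : (w i : ℝ) ≤ W := by
        rw [← hsum]
        exact Finset.single_le_sum (f := fun i => (w i : ℝ)) (fun _ _ => Nat.cast_nonneg _)
          (Finset.mem_univ i)
      rw [pow_succ]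
      gcongr
    refine (Finset.sum_le_sum fun i _ => h i).trans_eq ?_
    rw [← Finset.mul_sum, hsum, ← pow_succ]
  have hW' : (1 : ℝ) ≤ W := by exact_mod_cast hW
  have h1 := profile_mono hcube
  rw [profile_of_one_le (one_le_pow₀ hW'), Real.log_pow] at h1
  rw [lyapunov, hsum]
  have h2 := Real.log_two_lt_d9
  have h3 : 0 < Real.log 2 := Real.log_pos one_lt_two
  -- The constant 3 of the profile is covered by the `+ 1` and this term.
  have h4 : 2 ≤ 3.24 * (1 / (2 * Real.log 2)) := by
    rw [mul_one_div, le_div_iff₀ (by positivity)]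
    norm_num
    linarith
  have h5 : 27 / 25 / Real.log 2 * ((3 : ℕ) * Real.log W) = 3.24 * Real.logb 2 W := by
    rw [Real.logb]
    push_cast
    ring
  rw [h5] at h1
  linarith

/-! ### The expected makespan -/

/-- The transition axiom conditions on whole histories; summing over the countably many pasts before
`t` leaves the one-step law. -/
theorem IsExecution.measure_eq_mul_step {Ω : Type*} [MeasurableSpace Ω] {μ : Measure Ω}
    {m W : ℕ} {w : ℕ → Ω → Fin m → ℕ} (hw : IsExecution μ m W w) (t : ℕ) (x y : Fin m → ℕ) :
    μ {ω | w t ω = x ∧ w (t + 1) ω = y} = μ {ω | w t ω = x} * step x y := by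
  have hmeas : Measurable fun ω (u : Fin t) => w u ω :=
    measurable_pi_lambda _ fun u => hw.measurable u
  have hsplit : ∀ E : Set Ω, MeasurableSet E →
      μ E = ∑' z : Fin t → Fin m → ℕ, μ ({ω | (fun u : Fin t => w u ω) = z} ∩ E) := by
    intro E hE
    rw [← measure_iUnion]
    · congr 1
      ext ω
      simp
    · intro a b hab
      refine Set.disjoint_left.2 fun ω h1 h2 => hab ?_
      exact h1.1.symm.trans h2.1
    · intro z
      exact (hmeas (measurableSet_singleton z)).inter hE
  have hx : MeasurableSet {ω | w t ω = x} := hw.measurable t (measurableSet_singleton x)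
  have hy : MeasurableSet {ω | w (t + 1) ω = y} := hw.measurable (t + 1) (measurableSet_singleton y)
  rw [hsplit {ω | w t ω = x ∧ w (t + 1) ω = y} (hx.inter hy), hsplit _ hx,
    ← ENNReal.tsum_mul_right]
  refine tsum_congr fun z => ?_
  let p : ℕ → Fin m → ℕ := fun u => if h : u < t then z ⟨u, h⟩ else if u = t then x else y
  have hp : ∀ u (h : u < t), p u = z ⟨u, h⟩ := fun u h => dif_pos h
  have hpt : p t = x := by simp [p]
  have hpt' : p (t + 1) = y := by simp [p]
  have hz : ∀ ω, (∀ u ≤ t, w u ω = p u) ↔ (fun u : Fin t => w u ω) = z ∧ w t ω = x := by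
    intro ω
    constructor
    · intro h
      refine ⟨funext fun u => ?_, by rw [h t le_rfl, hpt]⟩
      rw [h u u.2.le, hp u u.2]
    · rintro ⟨h1, h2⟩ u hu
      rcases hu.lt_or_eq with h | rfl
      · rw [hp u h, ← h1]
      · rw [h2, hpt]
  have htr := hw.transition t p
  rw [hpt, hpt'] at htr
  convert htr using 2
  · ext ω
    have h1 : (∀ u ≤ t + 1, w u ω = p u) ↔ (∀ u ≤ t, w u ω = p u) ∧ w (t + 1) ω = y := by
      rw [← hpt']
      constructor
      · exact fun h => ⟨fun u hu => h u (by omega), h _ le_rfl⟩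
      · rintro ⟨h1, h2⟩ u hu
        rcases Nat.lt_or_ge t u with h | h
        · obtain rfl : u = t + 1 := by omega
          exact h2
        · exact h1 u h
    simp only [Set.mem_inter_iff, Set.mem_ofPred_eq, h1, hz]
    tauto
  · congr 1
    ext ω
    simp only [Set.mem_inter_iff, Set.mem_ofPred_eq, hz]

theorem IsExecution.measure_succ {Ω : Type*} [MeasurableSpace Ω] {μ : Measure Ω}
    {m W : ℕ} {w : ℕ → Ω → Fin m → ℕ} (hw : IsExecution μ m W w) (t : ℕ) (y : Fin m → ℕ) :
    μ {ω | w (t + 1) ω = y} = ∑' x, μ {ω | w t ω = x} * step x y := by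
  simp only [← hw.measure_eq_mul_step]
  rw [← measure_iUnion]
  · congr 1
    ext ω
    simp
  · intro a b hab
    exact Set.disjoint_left.2 fun ω h1 h2 => hab (h1.1.symm.trans h2.1)
  · intro x
    exact (hw.measurable t (measurableSet_singleton x)).inter
      (hw.measurable (t + 1) (measurableSet_singleton y))

theorem IsExecution.lintegral_comp {Ω : Type*} [MeasurableSpace Ω] {μ : Measure Ω}
    {m W : ℕ} {w : ℕ → Ω → Fin m → ℕ} (hw : IsExecution μ m W w) (t : ℕ)
    (f : (Fin m → ℕ) → ℝ≥0∞) :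
    ∫⁻ ω, f (w t ω) ∂μ = ∑' x, μ {ω | w t ω = x} * f x := by
  rw [← lintegral_map (measurable_of_countable f) (hw.measurable t), lintegral_countable']
  refine tsum_congr fun x => ?_
  rw [Measure.map_apply (hw.measurable t) (measurableSet_singleton x), mul_comm]
  rfl

theorem IsExecution.lintegral_lyapunov_succ {Ω : Type*} [MeasurableSpace Ω] {μ : Measure Ω}
    {m W : ℕ} {w : ℕ → Ω → Fin m → ℕ} (hm : 1 ≤ m) (hw : IsExecution μ m W w) (t : ℕ) :
    ∫⁻ ω, (if w t ω = 0 then 0 else 1) ∂μ + ∫⁻ ω, ENNReal.ofReal (lyapunov (w (t + 1) ω)) ∂μ ≤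
      ∫⁻ ω, ENNReal.ofReal (lyapunov (w t ω)) ∂μ := by
  rw [hw.lintegral_comp t fun x => if x = 0 then 0 else 1,
    hw.lintegral_comp (t + 1) fun x => ENNReal.ofReal (lyapunov x),
    hw.lintegral_comp t fun x => ENNReal.ofReal (lyapunov x)]
  simp only [hw.measure_succ, ← ENNReal.tsum_mul_right]
  rw [ENNReal.tsum_comm, ← ENNReal.tsum_add]
  refine ENNReal.tsum_le_tsum fun x => ?_
  simp only [mul_assoc]
  rw [ENNReal.tsum_mul_left, ← mul_add]
  exact mul_le_mul_right (lyapunov_drift hm x) _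

/-- Every slot before the first empty one counts 1; if none is empty, the sum is infinite. -/
theorem makespan_le_tsum {m : ℕ} (x : ℕ → Fin m → ℕ) :
    makespan x ≤ ∑' t, if x t = 0 then 0 else 1 := by
  classical
  have hzero : ∀ t, (∀ i, x t i = 0) ↔ x t = 0 := fun t => by simp [funext_iff]
  simp only [makespan, hzero]
  by_cases h : ∃ t, x t = 0
  · refine (iInf₂_le (Nat.find h) (Nat.find_spec h)).trans ?_
    refine le_trans ?_ (ENNReal.sum_le_tsum (Finset.range (Nat.find h)))
    rw [Finset.sum_congr rfl fun t ht => if_neg (Nat.find_min h (Finset.mem_range.1 ht))]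
    simp
  · push Not at h
    simp only [if_neg (h _)]
    rw [ENNReal.tsum_const_eq_top_of_ne_zero one_ne_zero]
    exact le_top

end DLS

theorem theorem3 {Ω : Type*} [MeasurableSpace Ω] (μ : Measure Ω) [IsProbabilityMeasure μ]
    (m W : ℕ) (hm : 1 ≤ m) (hW : 1 ≤ W) (w : ℕ → Ω → Fin m → ℕ)
    (hw : DLS.IsExecution μ m W w) :
    ∫⁻ ω, DLS.makespan (fun t => w t ω) ∂μ ≤
      ENNReal.ofReal
        ((W : ℝ) / m + 3.24 * (Real.logb 2 W + 1 / (2 * Real.log 2)) + 1) := by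
  have htel : ∀ T, ∑ t ∈ Finset.range T, ∫⁻ ω, (if w t ω = 0 then 0 else 1) ∂μ +
      ∫⁻ ω, ENNReal.ofReal (DLS.lyapunov (w T ω)) ∂μ ≤
        ∫⁻ ω, ENNReal.ofReal (DLS.lyapunov (w 0 ω)) ∂μ := by
    intro T
    induction T with
    | zero => simp
    | succ T ih =>
      rw [Finset.sum_range_succ, add_assoc]
      exact (add_le_add_right (hw.lintegral_lyapunov_succ hm T) _).trans ih
  calc ∫⁻ ω, DLS.makespan (fun t => w t ω) ∂μ
      ≤ ∫⁻ ω, ∑' t, (if w t ω = 0 then 0 else 1) ∂μ :=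
        lintegral_mono fun ω => DLS.makespan_le_tsum fun t => w t ω
    _ = ∑' t, ∫⁻ ω, (if w t ω = 0 then 0 else 1) ∂μ :=
        lintegral_tsum fun t => ((measurable_of_countable
          fun x : Fin m → ℕ => if x = 0 then (0 : ℝ≥0∞) else 1).comp (hw.measurable t)).aemeasurable
    _ ≤ ∫⁻ ω, ENNReal.ofReal (DLS.lyapunov (w 0 ω)) ∂μ := by
        rw [ENNReal.tsum_eq_iSup_nat]
        exact iSup_le fun T => le_self_add.trans (htel T)
    _ ≤ ∫⁻ _, ENNReal.ofReal
        ((W : ℝ) / m + 3.24 * (Real.logb 2 W + 1 / (2 * Real.log 2)) + 1) ∂μ := by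
        refine lintegral_mono_ae ?_
        filter_upwards [hw.initial] with ω hω
        exact ENNReal.ofReal_le_ofReal (DLS.lyapunov_le hW _ hω)
    _ = _ := by simp
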